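/- Let $K$ be a field of characteristic zero and let $X$ be a smooth irreducible affine algebraic variety over $K$, with coordinate algebra $\mathcal O(X)$. Let $\mathcal D(X)=\bigcup_{i\ge 0}\mathcal D(X)_i\subseteq \mathrm{End}_K(\mathcal O(X))$ be the ring of $K$-linear differential operators on $X$, where $$\mathcal D(X)_0=\{u\in \mathrm{End}_K(\mathcal O(X)) : ur-ru=0 \text{ for all } r\in\mathcal O(X)\},$$ $$\mathcal D(X)_i=\{u\in \mathrm{End}_K(\mathcal O(X)) : ur-ru\in\mathcal D(X)_{i-1} \text{ for all } r\in\mathcal O(X)\}\quad (i\ge 1),$$ and $r\in\mathcal O(X)$ is identified with multiplication by $r$. Let $a\in\mathcal D(X)$ and let $f(t)\in K[t]$ be a polynomial of degree $>1$. Then $0$ is the only eigenvalue (in $K$) of the inner derivation $$\mathrm{ad}\,f(a):\mathcal D(X)\to\mathcal D(X),\qquad b\mapsto f(a)b-bf(a),$$ that is, for $\lambda\in K$ there is a nonzero $b\in\mathcal D(X)$ with $f(a)b-bf(a)=\lambda b$ if and only if $\lambda=0$. -/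

import Mathlib

open AlgebraicGeometry CategoryTheory

/-- The `K`-module `𝒟(R)ᵢ` of `K`-linear differential operators of order at most `i` on a
commutative `K`-algebra `R`: those `u ∈ End_K(R)` with `u r - r u = 0` for all `r ∈ R` if `i = 0`,
and with `u r - r u ∈ 𝒟(R)ᵢ₋₁` for all `r ∈ R` if `i > 0`. Here `r ∈ R` is identified with the
multiplication map by `r`. -/
def diffOpsOfOrder (K R : Type*) [CommRing K] [CommRing R] [Algebra K R] :
    ℕ → Submodule K (Module.End K R)
  | 0 =>
    { carrier := {u | ∀ r : R, u * LinearMap.mulLeft K r - LinearMap.mulLeft K r * u = 0}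
      zero_mem' := fun r => by simp
      add_mem' := fun {u v} hu hv r => by
        have h : (u + v) * LinearMap.mulLeft K r - LinearMap.mulLeft K r * (u + v) =
            (u * LinearMap.mulLeft K r - LinearMap.mulLeft K r * u) +
              (v * LinearMap.mulLeft K r - LinearMap.mulLeft K r * v) := by noncomm_ring
        rw [h, hu r, hv r, add_zero]
      smul_mem' := fun c u hu r => by
        rw [smul_mul_assoc, mul_smul_comm, ← smul_sub, hu r, smul_zero] }
  | i + 1 =>
    { carrier := {u | ∀ r : R,
        u * LinearMap.mulLeft K r - LinearMap.mulLeft K r * u ∈ diffOpsOfOrder K R i}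
      zero_mem' := fun r => by simp
      add_mem' := fun {u v} hu hv r => by
        have h : (u + v) * LinearMap.mulLeft K r - LinearMap.mulLeft K r * (u + v) =
            (u * LinearMap.mulLeft K r - LinearMap.mulLeft K r * u) +
              (v * LinearMap.mulLeft K r - LinearMap.mulLeft K r * v) := by noncomm_ring
        rw [h]
        exact add_mem (hu r) (hv r)
      smul_mem' := fun c u hu r => by
        rw [smul_mul_assoc, mul_smul_comm, ← smul_sub]
        exact Submodule.smul_mem _ c (hu r) }

section

variable {K R : Type*} [CommRing K] [CommRing R] [Algebra K R]

theorem mem_diffOpsOfOrder_zero {u : Module.End K R} :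
    u ∈ diffOpsOfOrder K R 0 ↔
      ∀ r : R, u * LinearMap.mulLeft K r - LinearMap.mulLeft K r * u = 0 := Iff.rfl

theorem mem_diffOpsOfOrder_succ {i : ℕ} {u : Module.End K R} :
    u ∈ diffOpsOfOrder K R (i + 1) ↔
      ∀ r : R, u * LinearMap.mulLeft K r - LinearMap.mulLeft K r * u ∈
        diffOpsOfOrder K R i := Iff.rfl

theorem diffOpsOfOrder_le_succ (i : ℕ) :
    diffOpsOfOrder K R i ≤ diffOpsOfOrder K R (i + 1) := by
  induction i with
  | zero =>
    intro u hu r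
    rw [mem_diffOpsOfOrder_zero] at hu
    rw [hu r]
    exact zero_mem _
  | succ i ih => exact fun u hu r => ih (hu r)

theorem diffOpsOfOrder_mono : Monotone (diffOpsOfOrder K R) :=
  monotone_nat_of_le_succ diffOpsOfOrder_le_succ

theorem mul_mem_diffOpsOfOrder (n : ℕ) : ∀ (i j : ℕ), i + j = n → ∀ (u v : Module.End K R),
    u ∈ diffOpsOfOrder K R i → v ∈ diffOpsOfOrder K R j →
      u * v ∈ diffOpsOfOrder K R (i + j) := by
  have key : ∀ (u v m : Module.End K R),
      (u * v) * m - m * (u * v) = u * (v * m - m * v) + (u * m - m * u) * v := by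
    intro u v m
    simp only [mul_sub, sub_mul, mul_assoc]
    abel
  induction n with
  | zero =>
    intro i j hij u v hu hv
    obtain ⟨rfl, rfl⟩ : i = 0 ∧ j = 0 := by omega
    intro r
    rw [key, hu r, hv r, mul_zero, zero_mul, add_zero]
  | succ n ih =>
    intro i j hij u v hu hv
    rw [hij]
    intro r
    rw [key]
    refine add_mem ?_ ?_
    · cases j with
      | zero => rw [hv r, mul_zero]; exact zero_mem _
      | succ j =>
        have h := ih i j (by omega) u _ hu (hv r)
        rwa [show i + j = n by omega] at h
    · cases i with
      | zero => rw [hu r, zero_mul]; exact zero_mem _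
      | succ i =>
        have h := ih i j (by omega) _ v (hu r) hv
        rwa [show i + j = n by omega] at h

end

/-- The ring `𝒟(R) = ⋃ᵢ 𝒟(R)ᵢ` of `K`-linear differential operators on a commutative
`K`-algebra `R`, as a subalgebra of `End_K(R)`. -/
def diffOps (K R : Type*) [CommRing K] [CommRing R] [Algebra K R] :
    Subalgebra K (Module.End K R) where
  carrier := {u | ∃ i : ℕ, u ∈ diffOpsOfOrder K R i}
  mul_mem' := fun ⟨i, hu⟩ ⟨j, hv⟩ => ⟨i + j, mul_mem_diffOpsOfOrder _ i j rfl _ _ hu hv⟩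
  add_mem' := fun ⟨i, hu⟩ ⟨j, hv⟩ =>
    ⟨max i j, add_mem (diffOpsOfOrder_mono (le_max_left i j) hu)
      (diffOpsOfOrder_mono (le_max_right i j) hv)⟩
  algebraMap_mem' := fun c => ⟨0, fun _ => sub_eq_zero.mpr (Algebra.commutes c _)⟩

/-- The inner derivation `ad x : b ↦ x b - b x` of an associative `K`-algebra `A`, as a `K`-linear
endomorphism of `A`. -/
def innerDer (K : Type*) {A : Type*} [CommRing K] [Ring A] [Algebra K A] (x : A) :
    Module.End K A :=
  LinearMap.mulLeft K x - LinearMap.mulRight K x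

universe u

/-- The ring `𝒪(X)` of global functions on a `K`-scheme `π : X ⟶ Spec K`; for affine `X` this is
the coordinate algebra of `X`. -/
def CoordAlg {K : Type u} [Field K] {X : Scheme.{u}} (_π : X ⟶ Spec (CommRingCat.of K)) :
    Type u :=
  Γ(X, ⊤)

instance CoordAlg.instCommRing {K : Type u} [Field K] {X : Scheme.{u}}
    (π : X ⟶ Spec (CommRingCat.of K)) : CommRing (CoordAlg π) :=
  inferInstanceAs (CommRing Γ(X, ⊤))

/-- The `K`-algebra structure on `𝒪(X)` given by the structure morphism. -/
noncomputable instance CoordAlg.instAlgebra {K : Type u} [Field K] {X : Scheme.{u}}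
    (π : X ⟶ Spec (CommRingCat.of K)) : Algebra K (CoordAlg π) :=
  RingHom.toAlgebra (S := CoordAlg π)
    ((Scheme.ΓSpecIso (CommRingCat.of K)).inv ≫ π.appTop).hom

/-- The ring `𝒟(X) = 𝒟(𝒪(X))` of differential operators on an affine `K`-scheme `X`. -/
noncomputable abbrev DiffOpRing {K : Type u} [Field K] {X : Scheme.{u}}
    (π : X ⟶ Spec (CommRingCat.of K)) : Subalgebra K (Module.End K (CoordAlg π)) :=
  diffOps K (CoordAlg π)

/-! Filter the operators by order. A smooth irreducible variety is integral, so `CoordAlg π` is a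
domain of characteristic zero, and there orders add in products (`mul_notMem_diffOpsOrderLT`). An
operator of exact order n has a nonzero symbol r ↦ `(commMul K r ^ n) u 1`, and symbols multiply up
to a binomial factor. Suppose [f(a), v] = c v with c ≠ 0 and v ≠ 0 of minimal order. If a has order
0, so does f(a), and the commutator lowers the order of v. Otherwise let d > 0 be the order of a.
Then w = [a, v] is nonzero and is again an eigenvector for c, because f(a) commutes with a. By
minimality, w has order at least that of v. Modulo lower order, [f(a), v] is a nonzero multiple of a
^ (deg f - 1) w, so its order exceeds that of w by d (deg f - 1) > 0. Hence it cannot equal c v. -/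

section DifferentialOperators

/-! ### Order filtration and commutators. -/

variable {K R : Type*} [CommRing K] [CommRing R] [Algebra K R]

/-- The differential operators of order strictly less than `n`. -/
def diffOpsOrderLT (K R : Type*) [CommRing K] [CommRing R] [Algebra K R] :
    ℕ → Submodule K (Module.End K R)
  | 0 => ⊥
  | n + 1 => diffOpsOfOrder K R n

/-- The commutator `u ↦ u r - r u` with the multiplication by `r`. -/
def commMul (K : Type*) {R : Type*} [CommRing K] [CommRing R] [Algebra K R] (r : R) :
    Module.End K (Module.End K R) :=
  LinearMap.mulRight K (LinearMap.mulLeft K r) - LinearMap.mulLeft K (LinearMap.mulLeft K r)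

theorem commMul_apply (r : R) (u : Module.End K R) :
    commMul K r u = u * LinearMap.mulLeft K r - LinearMap.mulLeft K r * u := rfl

theorem innerDer_apply {A : Type*} [Ring A] [Algebra K A] (x b : A) :
    innerDer K x b = x * b - b * x := rfl

theorem commMul_mul (r : R) (u v : Module.End K R) :
    commMul K r (u * v) = commMul K r u * v + u * commMul K r v := by
  simp only [commMul_apply, mul_sub, sub_mul, mul_assoc]
  abel

theorem commMul_add_smul (r s : R) (t : K) :
    commMul K (r + t • s) = commMul K r + t • commMul K s := by
  ext u x
  simp [commMul_apply, add_mul, smul_sub]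
  abel

theorem commute_commMul (r s : R) : Commute (commMul K r) (commMul K s) := by
  ext u x
  simp only [Module.End.mul_apply, commMul_apply, LinearMap.sub_apply, LinearMap.mulLeft_apply,
    map_sub, mul_left_comm r s]
  ring

theorem mem_diffOpsOrderLT_succ {n : ℕ} {u : Module.End K R} :
    u ∈ diffOpsOrderLT K R (n + 1) ↔ ∀ r : R, commMul K r u ∈ diffOpsOrderLT K R n := by
  cases n with
  | zero => simp [diffOpsOrderLT, mem_diffOpsOfOrder_zero, commMul_apply]
  | succ n => exact Iff.rfl

theorem diffOpsOrderLT_mono : Monotone (diffOpsOrderLT K R) := by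
  refine monotone_nat_of_le_succ fun n => ?_
  cases n with
  | zero => exact bot_le
  | succ n => exact diffOpsOfOrder_le_succ n

theorem mul_mem_diffOpsOrderLT {i j : ℕ} {u v : Module.End K R}
    (hu : u ∈ diffOpsOrderLT K R (i + 1)) (hv : v ∈ diffOpsOrderLT K R j) :
    u * v ∈ diffOpsOrderLT K R (i + j) := by
  cases j with
  | zero =>
    rw [(Submodule.mem_bot K).mp hv, mul_zero]
    exact zero_mem _
  | succ j => exact mul_mem_diffOpsOfOrder _ i j rfl u v hu hv

theorem pow_mem_diffOpsOrderLT {d : ℕ} {a : Module.End K R}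
    (ha : a ∈ diffOpsOrderLT K R (d + 1)) (p : ℕ) :
    a ^ p ∈ diffOpsOrderLT K R (d * p + 1) := by
  induction p with
  | zero => exact fun r => by simp
  | succ p ih =>
    rw [pow_succ', show d * (p + 1) + 1 = d + (d * p + 1) by ring]
    exact mul_mem_diffOpsOrderLT ha ih

theorem eq_mulLeft_of_mem_diffOpsOrderLT_one {u : Module.End K R}
    (hu : u ∈ diffOpsOrderLT K R 1) : u = LinearMap.mulLeft K (u 1) := by
  ext x
  have h := LinearMap.congr_fun (hu x) 1
  simp [sub_eq_zero] at h
  simp [h, mul_comm]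

/-- Symbols commute because `R` does. Commuting with `r` is a derivation, so it passes to each
factor in turn and lowers its order. -/
theorem commutator_mem_diffOpsOrderLT (n : ℕ) : ∀ {i j : ℕ}, i + j = n →
    ∀ {u v : Module.End K R}, u ∈ diffOpsOrderLT K R (i + 1) → v ∈ diffOpsOrderLT K R (j + 1) →
      u * v - v * u ∈ diffOpsOrderLT K R n := by
  induction n with
  | zero =>
    intro i j hij u v hu hv
    obtain ⟨rfl, rfl⟩ : i = 0 ∧ j = 0 := by omega
    rw [eq_mulLeft_of_mem_diffOpsOrderLT_one hv]
    exact (Submodule.mem_bot K).mpr (hu _)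
  | succ n ih =>
    intro i j hij u v hu hv
    rw [mem_diffOpsOrderLT_succ]
    intro r
    have key : commMul K r (u * v - v * u) =
        (commMul K r u * v - v * commMul K r u) + (u * commMul K r v - commMul K r v * u) := by
      rw [map_sub, commMul_mul, commMul_mul]
      abel
    have hu' := mem_diffOpsOrderLT_succ.mp hu r
    have hv' := mem_diffOpsOrderLT_succ.mp hv r
    rw [key]
    refine add_mem ?_ ?_
    · cases i with
      | zero =>
        rw [(Submodule.mem_bot K).mp hu']
        simp
      | succ i => exact ih (by omega) hu' hv
    · cases j with
      | zero =>
        rw [(Submodule.mem_bot K).mp hv']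
        simp
      | succ j => exact ih (by omega) hu hv'

theorem commMul_pow_mem {i : ℕ} (n : ℕ) {u : Module.End K R}
    (hu : u ∈ diffOpsOrderLT K R (i + n)) (r : R) :
    (commMul K r ^ n) u ∈ diffOpsOrderLT K R i := by
  induction n generalizing u with
  | zero => simpa using hu
  | succ n ih =>
    rw [pow_succ, Module.End.mul_apply]
    exact ih (mem_diffOpsOrderLT_succ.mp hu r)

/-- The Leibniz rule for the top-order part of the commutators with `r`. -/
theorem commMul_pow_mul (r : R) (n : ℕ) : ∀ {i j : ℕ}, i + j = n → ∀ {u v : Module.End K R},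
    u ∈ diffOpsOrderLT K R (i + 1) → v ∈ diffOpsOrderLT K R (j + 1) →
      (commMul K r ^ n) (u * v) =
        n.choose i • ((commMul K r ^ i) u * (commMul K r ^ j) v) := by
  induction n with
  | zero =>
    intro i j hij u v hu hv
    obtain ⟨rfl, rfl⟩ : i = 0 ∧ j = 0 := by omega
    simp
  | succ n ih =>
    intro i j hij u v hu hv
    have hu' := mem_diffOpsOrderLT_succ.mp hu r
    have hv' := mem_diffOpsOrderLT_succ.mp hv r
    rw [pow_succ, Module.End.mul_apply, commMul_mul, map_add]
    rcases i with _ | i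
    · obtain rfl : j = n + 1 := by omega
      rw [(Submodule.mem_bot K).mp hu', ih (i := 0) (j := n) (by omega) hu hv']
      simp [pow_succ (commMul K r) n]
    rcases j with _ | j
    · obtain rfl : i = n := by omega
      rw [(Submodule.mem_bot K).mp hv', ih (i := i) (j := 0) (by omega) hu' hv]
      simp [pow_succ (commMul K r) i]
    · rw [ih (i := i) (j := j + 1) (by omega) hu' hv, ih (i := i + 1) (j := j) (by omega) hu hv',
        Nat.choose_succ_succ, add_smul]
      simp [pow_succ]

/-- If `a` and `v` have commutator `w`, then modulo lower order `[a ^ p, v] = p a ^ (p - 1) w`. -/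
theorem pow_commutator_mem {d k : ℕ} {a v : Module.End K R}
    (ha : a ∈ diffOpsOrderLT K R (d + 1)) (hw : a * v - v * a ∈ diffOpsOrderLT K R (k + 1))
    (p : ℕ) :
    a ^ (p + 1) * v - v * a ^ (p + 1) - (p + 1) • (a ^ p * (a * v - v * a)) ∈
      diffOpsOrderLT K R (d * p + k) := by
  induction p with
  | zero => simp
  | succ p ih =>
    set w := a * v - v * a with hw_def
    -- Leibniz gives the term w a ^ (p + 1); moving w to the right costs a commutator of lower
    -- order.
    have key : a ^ (p + 1 + 1) * v - v * a ^ (p + 1 + 1) - (p + 1 + 1) • (a ^ (p + 1) * w) =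
        a * (a ^ (p + 1) * v - v * a ^ (p + 1) - (p + 1) • (a ^ p * w)) -
          (a ^ (p + 1) * w - w * a ^ (p + 1)) := by
      rw [succ_nsmul, mul_sub a, mul_sub a, mul_smul_comm, ← mul_assoc a (a ^ p),
        ← pow_succ' a p, hw_def, sub_mul _ _ (a ^ (p + 1)), mul_assoc v a, ← pow_succ',
        pow_succ' a (p + 1)]
      noncomm_ring
    rw [key]
    refine sub_mem ?_ (commutator_mem_diffOpsOrderLT _ rfl (pow_mem_diffOpsOrderLT ha _) hw)
    have h := mul_mem_diffOpsOrderLT ha ih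
    rwa [show d + (d * p + k) = d * (p + 1) + k by ring] at h

end DifferentialOperators

/-! ### Symbols over a domain and additivity of order. -/

section Domain

open Polynomial

variable {K R : Type*} [Field K] [CommRing R] [Algebra K R]

/-- The value at `1` of the `n`-th commutator of `u` with `r + t s`, as a polynomial in `t`. -/
noncomputable def linePolynomial (K : Type*) {R : Type*} [CommRing K] [CommRing R] [Algebra K R]
    (n : ℕ) (u : Module.End K R) (r s : R) : R[X] :=
  ∑ m ∈ Finset.range (n + 1),
    monomial m (n.choose m • ((commMul K s ^ m * commMul K r ^ (n - m)) u 1))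

theorem eval_linePolynomial (n : ℕ) (u : Module.End K R) (r s : R) (t : K) :
    (linePolynomial K n u r s).eval (algebraMap K R t) = (commMul K (r + t • s) ^ n) u 1 := by
  rw [commMul_add_smul, add_comm, ((commute_commMul s r).smul_left t).add_pow, linePolynomial,
    eval_finsetSum, LinearMap.sum_apply, LinearMap.sum_apply]
  refine Finset.sum_congr rfl fun m _ => ?_
  rw [eval_monomial, _root_.smul_pow, ← (Nat.cast_commute _ _).eq, ← nsmul_eq_mul, smul_mul_assoc]
  simp only [LinearMap.smul_apply]
  rw [smul_mul_assoc (t ^ m), LinearMap.smul_apply, LinearMap.smul_apply,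
    Algebra.smul_def (R := K) (A := R), map_pow, mul_comm]

theorem coeff_linePolynomial {n m : ℕ} (hm : m ≤ n) (u : Module.End K R) (r s : R) :
    (linePolynomial K n u r s).coeff m =
      n.choose m • ((commMul K s ^ m * commMul K r ^ (n - m)) u 1) := by
  simp only [linePolynomial, finsetSum_coeff, coeff_monomial]
  rw [Finset.sum_ite_eq' (Finset.range (n + 1)) m, if_pos (Finset.mem_range.mpr (by omega))]

theorem exists_mem_diffOpsOrderLT_succ_notMem {n : ℕ} {u : Module.End K R}
    (hu : u ∈ diffOpsOrderLT K R n) (h0 : u ≠ 0) :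
    ∃ k, u ∈ diffOpsOrderLT K R (k + 1) ∧ u ∉ diffOpsOrderLT K R k := by
  classical
  have hex : ∃ n, u ∈ diffOpsOrderLT K R n := ⟨n, hu⟩
  rcases hk : Nat.find hex with _ | k
  · have h := Nat.find_spec hex
    rw [hk] at h
    exact absurd ((Submodule.mem_bot K).mp h) h0
  · refine ⟨k, ?_, Nat.find_min hex (by omega)⟩
    rw [← hk]
    exact Nat.find_spec hex

theorem aeval_mem_diffOpsOrderLT_one {a : Module.End K R} (ha : a ∈ diffOpsOrderLT K R 1)
    (f : K[X]) : aeval a f ∈ diffOpsOrderLT K R 1 := by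
  rw [aeval_eq_sum_range]
  refine sum_mem fun p _ => Submodule.smul_mem _ _ ?_
  simpa using pow_mem_diffOpsOrderLT (d := 0) ha p

variable [CharZero K] [IsDomain R]

theorem Polynomial.exists_eval_algebraMap_ne_zero {p : R[X]} (hp : p ≠ 0) :
    ∃ t : K, p.eval (algebraMap K R t) ≠ 0 := by
  by_contra! h
  refine hp (p.eq_zero_of_infinite_isRoot ?_)
  exact (Set.infinite_range_of_injective (algebraMap K R).injective).mono
    (by rintro _ ⟨t, rfl⟩; exact h t)

/-- Polarization: the symbol vanishes on every line r + t s, and `K` is infinite, so the coefficient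
of t vanishes. That coefficient is n + 1 times the symbol of `commMul K s u` at r. -/
theorem mem_diffOpsOrderLT_of_commMul_pow_eq_zero {n : ℕ} {u : Module.End K R}
    (hu : u ∈ diffOpsOrderLT K R (n + 1)) (h : ∀ r, (commMul K r ^ n) u 1 = 0) :
    u ∈ diffOpsOrderLT K R n := by
  have := charZero_of_injective_algebraMap (algebraMap K R).injective
  induction n generalizing u with
  | zero =>
    rw [eq_mulLeft_of_mem_diffOpsOrderLT_one hu, show u 1 = 0 from h 0]
    simp
  | succ n ih =>
    rw [mem_diffOpsOrderLT_succ]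
    intro s
    refine ih (mem_diffOpsOrderLT_succ.mp hu s) fun r => ?_
    have hp : linePolynomial K (n + 1) u r s = 0 := by
      by_contra hp
      obtain ⟨t, ht⟩ := Polynomial.exists_eval_algebraMap_ne_zero (K := K) hp
      exact ht (by rw [eval_linePolynomial, h])
    have h1 := coeff_linePolynomial (n := n + 1) (m := 1) (by omega) u r s
    rw [hp, coeff_zero, pow_one, ((commute_commMul s r).pow_right _).eq] at h1
    simpa [Nat.cast_add_one_ne_zero] using h1.symm

/-- Orders of differential operators on a domain of characteristic zero add up in products. -/
theorem mul_notMem_diffOpsOrderLT {i j : ℕ} {u v : Module.End K R}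
    (hu : u ∈ diffOpsOrderLT K R (i + 1)) (hu' : u ∉ diffOpsOrderLT K R i)
    (hv : v ∈ diffOpsOrderLT K R (j + 1)) (hv' : v ∉ diffOpsOrderLT K R j) :
    u * v ∉ diffOpsOrderLT K R (i + j) := by
  have := charZero_of_injective_algebraMap (algebraMap K R).injective
  intro huv
  obtain ⟨r, hr⟩ : ∃ r, (commMul K r ^ i) u 1 ≠ 0 := by
    by_contra! h
    exact hu' (mem_diffOpsOrderLT_of_commMul_pow_eq_zero hu h)
  obtain ⟨s, hs⟩ : ∃ s, (commMul K s ^ j) v 1 ≠ 0 := by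
    by_contra! h
    exact hv' (mem_diffOpsOrderLT_of_commMul_pow_eq_zero hv h)
  -- The constant coefficient is the symbol of u at r; for v, the top coefficient is its symbol at
  -- s. A common t then makes both symbols nonzero at r + t s.
  have hp : linePolynomial K i u r s ≠ 0 := by
    intro h
    have := coeff_linePolynomial (m := 0) (Nat.zero_le i) u r s
    simp [h] at this
    exact hr this.symm
  have hq : linePolynomial K j v r s ≠ 0 := by
    intro h
    have := coeff_linePolynomial (m := j) le_rfl v r s
    simp [h] at this
    exact hs this.symm
  obtain ⟨t, ht⟩ := Polynomial.exists_eval_algebraMap_ne_zero (K := K) (mul_ne_zero hp hq)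
  rw [eval_mul, eval_linePolynomial, eval_linePolynomial] at ht
  set x := r + t • s
  have hL := commMul_pow_mul x (i + j) rfl hu hv
  have h0 : (commMul K x ^ (i + j)) (u * v) = 0 :=
    (Submodule.mem_bot K).mp (commMul_pow_mem (i := 0) (i + j) (by simpa using huv) x)
  have hU := eq_mulLeft_of_mem_diffOpsOrderLT_one
    (commMul_pow_mem (i := 1) i (by rwa [add_comm]) x : (commMul K x ^ i) u ∈ _)
  have h1 := LinearMap.congr_fun hL 1
  rw [h0, hU] at h1
  simp only [LinearMap.zero_apply, LinearMap.smul_apply, Module.End.mul_apply,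
    LinearMap.mulLeft_apply] at h1
  have hc : (i + j).choose i ≠ 0 := (Nat.choose_pos (by omega)).ne'
  exact smul_ne_zero hc ht h1.symm

theorem pow_notMem_diffOpsOrderLT {d : ℕ} {a : Module.End K R}
    (ha : a ∈ diffOpsOrderLT K R (d + 1)) (ha' : a ∉ diffOpsOrderLT K R d) (p : ℕ) :
    a ^ p ∉ diffOpsOrderLT K R (d * p) := by
  induction p with
  | zero => simp [diffOpsOrderLT]
  | succ p ih =>
    rw [pow_succ', show d * (p + 1) = d + d * p by ring]
    exact mul_notMem_diffOpsOrderLT ha ha' (pow_mem_diffOpsOrderLT ha p) ih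

/-- For `a` of positive order `d` and `f` of degree `m + 1 > 1`, the commutator `[f(a), v]` has
order `d m` plus the order of `[a, v]`. -/
theorem aeval_commutator_notMem {d k : ℕ} (hd : 0 < d) {a v : Module.End K R}
    (ha : a ∈ diffOpsOrderLT K R (d + 1)) (ha' : a ∉ diffOpsOrderLT K R d)
    (hw : a * v - v * a ∈ diffOpsOrderLT K R (k + 1))
    (hw' : a * v - v * a ∉ diffOpsOrderLT K R k) {f : K[X]} {m : ℕ} (hf : f.natDegree = m + 1) :
    aeval a f * v - v * aeval a f ∉ diffOpsOrderLT K R (d * m + k) := by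
  -- Since d > 0, only the leading term of f reaches order d m + k.
  have term_mem : ∀ p, p < m →
      a ^ (p + 1) * v - v * a ^ (p + 1) ∈ diffOpsOrderLT K R (d * m + k) := by
    intro p hp
    have hle : d * p + d ≤ d * m := by nlinarith
    have h1 := diffOpsOrderLT_mono (show d * p + k ≤ d * m + k by omega)
      (pow_commutator_mem ha hw p)
    have h2 := diffOpsOrderLT_mono (show d * p + (k + 1) ≤ d * m + k by omega)
      (mul_mem_diffOpsOrderLT (pow_mem_diffOpsOrderLT ha p) hw)
    simpa using add_mem h1 (nsmul_mem h2 (p + 1))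
  have hsum : aeval a f * v - v * aeval a f =
      (∑ p ∈ Finset.range m, f.coeff (p + 1) • (a ^ (p + 1) * v - v * a ^ (p + 1))) +
        f.coeff (m + 1) • (a ^ (m + 1) * v - v * a ^ (m + 1)) := by
    rw [aeval_eq_sum_range, hf, Finset.sum_mul, Finset.mul_sum, ← Finset.sum_sub_distrib,
      Finset.sum_range_succ, Finset.sum_range_succ']
    simp [smul_sub]
  intro h
  rw [hsum] at h
  have hc : f.coeff (m + 1) ≠ 0 := by
    rw [← hf]
    exact leadingCoeff_ne_zero.mpr (by rintro rfl; simp at hf)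
  have h1 := (Submodule.add_mem_iff_right _
    (sum_mem fun p hp => Submodule.smul_mem _ _ (term_mem p (Finset.mem_range.mp hp)))).mp h
  have h2 := (Submodule.smul_mem_iff _ hc).mp h1
  have h3 := sub_mem h2 (pow_commutator_mem ha hw m)
  rw [sub_sub_cancel, ← Nat.cast_smul_eq_nsmul K] at h3
  have h4 := (Submodule.smul_mem_iff _ (Nat.cast_ne_zero.mpr m.succ_ne_zero)).mp h3
  exact mul_notMem_diffOpsOrderLT (pow_mem_diffOpsOrderLT ha m) (pow_notMem_diffOpsOrderLT ha ha' m)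
    hw hw' h4

/-! ### Descent on the order of an eigenvector. -/

theorem aeval_commutator_ne_smul {a : Module.End K R} (ha : a ∈ diffOps K R) {f : K[X]}
    (hf : 1 < f.natDegree) {c : K} (hc : c ≠ 0) (n : ℕ) {v : Module.End K R} (hv0 : v ≠ 0)
    (hv : v ∈ diffOpsOrderLT K R n) : aeval a f * v - v * aeval a f ≠ c • v := by
  induction n using Nat.strong_induction_on generalizing v with
  | _ n ih =>
  intro hfv
  obtain ⟨e, hae⟩ := ha
  rcases n with _ | n
  · exact hv0 ((Submodule.mem_bot K).mp hv)
  by_cases ha1 : a ∈ diffOpsOrderLT K R 1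
  · refine ih n (by omega) hv0 ?_ hfv
    rw [← Submodule.smul_mem_iff _ hc, ← hfv]
    exact commutator_mem_diffOpsOrderLT n (zero_add n) (aeval_mem_diffOpsOrderLT_one ha1 f) hv
  obtain ⟨d, had, had'⟩ := exists_mem_diffOpsOrderLT_succ_notMem
    (show a ∈ diffOpsOrderLT K R (e + 1) from hae) (by rintro rfl; exact ha1 (zero_mem _))
  have hd : 0 < d := Nat.pos_of_ne_zero (by rintro rfl; exact ha1 had)
  have hfa : Commute (aeval a f) a := by
    simpa only [aeval_X] using (Commute.all f X).map (aeval a)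
  have hw0 : a * v - v * a ≠ 0 := by
    intro h
    have hcomm : Commute (aeval a f) v := by
      refine (Algebra.commute_of_mem_adjoin_of_forall_mem_commute
        (aeval_mem_adjoin_singleton K a) ?_).symm
      rintro _ rfl
      exact (sub_eq_zero.mp h).symm
    rw [sub_eq_zero.mpr hcomm.eq] at hfv
    exact smul_ne_zero hc hv0 hfv.symm
  have hwn : a * v - v * a ∈ diffOpsOrderLT K R (d + (n + 1)) := by
    refine sub_mem (mul_mem_diffOpsOrderLT had hv) ?_
    rw [show d + (n + 1) = n + (d + 1) by ring]
    exact mul_mem_diffOpsOrderLT hv had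
  have hfw : aeval a f * (a * v - v * a) - (a * v - v * a) * aeval a f = c • (a * v - v * a) := by
    rw [smul_sub, ← mul_smul_comm, ← smul_mul_assoc, ← hfv]
    simp only [mul_sub, sub_mul, mul_assoc, hfa.eq]
    simp only [← mul_assoc, hfa.eq]
    abel
  obtain ⟨k, hwk, hwk'⟩ := exists_mem_diffOpsOrderLT_succ_notMem hwn hw0
  -- Minimality of v applied to the eigenvector w = [a, v].
  have hnk : n ≤ k := by
    by_contra! hlt
    exact ih (k + 1) (by omega) hw0 hwk hfw
  refine aeval_commutator_notMem hd had had' hwk hwk' (f := f) (m := f.natDegree - 1) (by omega) ?_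
  rw [hfv]
  have : 0 < d * (f.natDegree - 1) := Nat.mul_pos hd (by omega)
  exact Submodule.smul_mem _ _ (diffOpsOrderLT_mono (by omega) hv)

theorem hasEigenvalue_innerDer_aeval_iff (a : diffOps K R) (f : K[X]) (hf : 1 < f.natDegree)
    (μ : K) :
    Module.End.HasEigenvalue (M := diffOps K R) (innerDer K (aeval a f)) μ ↔ μ = 0 := by
  constructor
  · intro h
    by_contra hμ
    obtain ⟨b, hb⟩ := h.exists_hasEigenvector
    obtain ⟨i, hi⟩ := b.2
    refine aeval_commutator_ne_smul a.2 hf hμ (i + 1) (v := b) (by simpa using hb.2) hi ?_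
    have := congrArg Subtype.val hb.apply_eq_smul
    simpa [innerDer_apply, aeval_subalgebra_coe] using this
  · rintro rfl
    refine Module.End.hasEigenvalue_of_hasEigenvector (x := 1) ?_
    rw [Module.End.hasEigenvector_iff, Module.End.mem_eigenspace_iff]
    exact ⟨by simp [innerDer_apply], one_ne_zero⟩

end Domain

/-- Let `X` be a smooth irreducible affine variety over a field `K` of characteristic zero, let
`a ∈ 𝒟(X)`, and let `f ∈ K[t]` have degree `> 1`. Then `0` is the only eigenvalue of the inner
derivation `ad f(a) : b ↦ f(a) b - b f(a)` of `𝒟(X)`. -/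
theorem theorem1p2 {K : Type u} [Field K] [CharZero K] {X : Scheme.{u}}
    (π : X ⟶ Spec (CommRingCat.of K)) [IsAffine X] [AlgebraicGeometry.IsReduced X]
    [IrreducibleSpace X] [Smooth π]
    (a : DiffOpRing π) (f : Polynomial K) (hf : 1 < f.natDegree) (μ : K) :
    Module.End.HasEigenvalue (M := DiffOpRing π) (innerDer K (Polynomial.aeval a f)) μ ↔ μ = 0 := by
  have : IsIntegral X := isIntegral_of_irreducibleSpace_of_isReduced X
  have : IsDomain (CoordAlg π) := inferInstanceAs (IsDomain Γ(X, ⊤))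
  exact hasEigenvalue_innerDer_aeval_iff a f hf μ
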